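/- For $h>0$ and $N_t\in\mathbb{N}$, $N_t\ge 1$, put $T=\sqrt{N_t h/4}$ and let $$r_t(x)=\frac{xh}{\pi}\sum_{j=1}^{N_t}\frac{1}{\sqrt{jh}}\,\frac{e^{\sqrt{jh}-\sqrt{N_t h/4}}}{e^{2\sqrt{jh}-2\sqrt{N_t h/4}}+x},\qquad x\in[0,1].$$ For $x>0$ and $u\in\mathbb{C}$ let $$f(u,x)=\frac{x}{\pi}\,\frac{1}{\sqrt{u}}\,\frac{e^{\sqrt{u}-T}}{e^{2(\sqrt{u}-T)}+x}\ \text{(principal square root)},\qquad \delta(u)=\mu(u)+\frac{i}{2}\cot\Big(\frac{\pi u}{h}\Big),$$ where $\mu(u)=-\tfrac12$ if $\operatorname{Im}u\ge 0$ and $\mu(u)=\tfrac12$ if $\operatorname{Im}u<0$. Theorem. Let $h=2\pi^2$. Assume that for all sufficiently large $N_t$ the following bound holds: for every $x\in[e^{4-2T},1]$, $$\Big|\int_\Gamma f(u,x)\,\delta(u)\,du\Big|<12\,e^{-T},$$ where $\Gamma$ is the positively oriented boundary of the rectangle $[1,4T^2+1]\times[-ai,ai]$ with $a=2\pi\big(T+\tfrac12\log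 x\big)$. Then $r_t$ converges to $\sqrt{x}$ uniformly on $[0,1]$ as $N_t\to\infty$, and for all sufficiently large $N_t$, $$|r_t(x)-\sqrt{x}|<20\,e^{-\sqrt{N_t h/4}}=20\,e^{-\pi\sqrt{N_t/2}}\qquad\text{for all }x\in[0,1].$$ -/

import Mathlib

open Filter Topology

noncomputable section

namespace TrapSqrt

/-- The truncation parameter `T = √(N h / 4)`. -/
def truncT (h : ℝ) (N : ℕ) : ℝ := Real.sqrt (N * h / 4)

/-- The trapezoidal-rule rational function
`r_t(x) = (x h / π) ∑_{j=1}^{N} (jh)^{-1/2} e^{√(jh) - T} / (e^{2√(jh) - 2T} + x)`,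
with `T = √(N h / 4)`. -/
def rTrap (h : ℝ) (N : ℕ) (x : ℝ) : ℝ :=
  x * h / Real.pi *
    ∑ j ∈ Finset.Icc 1 N,
      1 / Real.sqrt (j * h) *
        (Real.exp (Real.sqrt (j * h) - Real.sqrt (N * h / 4)) /
          (Real.exp (2 * Real.sqrt (j * h) - 2 * Real.sqrt (N * h / 4)) + x))

/-- The integrand `f(u, x) = (x / π) u^{-1/2} e^{√u - T} / (e^{2(√u - T)} + x)` for complex `u`,
with the principal square root. -/
def integrand (T x : ℝ) (u : ℂ) : ℂ :=
  (x : ℂ) / (Real.pi : ℂ) * (1 / Complex.sqrt u) *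
    (Complex.exp (Complex.sqrt u - (T : ℂ)) /
      (Complex.exp (2 * (Complex.sqrt u - (T : ℂ))) + (x : ℂ)))

/-- `μ(u) = -1/2` if `Im u ≥ 0`, and `1/2` if `Im u < 0`. -/
def charMu (u : ℂ) : ℂ := if 0 ≤ u.im then -(1 / 2) else 1 / 2

/-- `m(u) = -(i/2) cot(π u / h)`. -/
def charM (h : ℝ) (u : ℂ) : ℂ :=
  -(Complex.I / 2) * Complex.cot ((Real.pi : ℂ) * u / (h : ℂ))

/-- `δ(u) = μ(u) - m(u)`. -/
def charDelta (h : ℝ) (u : ℂ) : ℂ := charMu u - charM h u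

/-- The integral of `F` along the positively oriented boundary of the rectangle
`[p, q] × [c, d]`: bottom, right, top and left side, in this order. -/
def rectIntegral (F : ℂ → ℂ) (p q c d : ℝ) : ℂ :=
  (∫ t in p..q, F ((t : ℂ) + (c : ℂ) * Complex.I)) +
    Complex.I * (∫ s in c..d, F ((q : ℂ) + (s : ℂ) * Complex.I)) -
    (∫ t in p..q, F ((t : ℂ) + (d : ℂ) * Complex.I)) -
    Complex.I * (∫ s in c..d, F ((p : ℂ) + (s : ℂ) * Complex.I))

/-- The contour-integral bound with `N` quadrature points and step `h`: for all
`x ∈ [e^{4-2T}, 1]`, with `a = 2π (T + (log x) / 2)` and `Γ` the positively oriented rectangle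
`[1, 4T² + 1] × [-a i, a i]`, one has `|∫_Γ f(u, x) δ(u) du| < 12 e^{-T}`. -/
def ContourBound (h : ℝ) (N : ℕ) : Prop :=
  ∀ x ∈ Set.Icc (Real.exp (4 - 2 * truncT h N)) 1,
    ‖rectIntegral (fun u => integrand (truncT h N) x u * charDelta h u)
        1 (4 * truncT h N ^ 2 + 1)
        (-(2 * Real.pi * (truncT h N + Real.log x / 2)))
        (2 * Real.pi * (truncT h N + Real.log x / 2))‖
      < 12 * Real.exp (-truncT h N)

end TrapSqrt

end

/-!
The rule `r_t(x)` is the right-endpoint Riemann sum with step `h` of the function `f(·, x)`, whose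
integral over `[0, ∞)` differs from `√x` by `O(e^{-T})`. Let `I(x)` be the integral of `f(·, x)`
over `[1, 4T² + 1]`.

For `x ≥ e^{4 - 2T}` put `b = T + (log x) / 2`, so that `b ≥ 2` and `√x e^{-b} = e^{-T}`. The weight
`δ` has a simple pole at every node `j h`, and its jump `μ` across the real axis adds the integral
of `f` over `[1, 4T² + 1]` to the contour integral. The residue theorem therefore gives
(`rectIntegral_mul_charDelta`)

  `∮ f δ = I(x) - r_t(x) + 2πi ∑ Res(f, w) δ(w)`,

where `w` runs over the poles `(b ± iπ/2)²` of `f` in the rectangle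
(`eq_pole_of_integrandDen_eq_zero`). There `2πi Res(f, w) = ± 2√x`
(`tendsto_sub_mul_integrand_pole`), and `|δ(w)| ≤ e^{-b} / (1 - e^{-b})` because `Im w = ± π b` and
`h = 2π²` (`norm_charDelta_le`). With the assumed bound on the contour integral this yields
`|r_t(x) - I(x)| ≤ (12 + 14/3) e^{-T}` (`abs_rTrap_sub_integral_le`). A primitive of `f(·, x)` is
`(2√x / π) arctan (e^{√u - T} / √x)`, whence `|I(x) - √x| ≤ (5/2) e^{-T}`
(`abs_integral_sub_sqrt_le`), and `12 + 14/3 + 5/2 < 20`.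

For `x < e^{4 - 2T}` the contour is of no use, but there `√x` and `r_t(x)` are both nonnegative and
smaller than `20 e^{-T}` (`abs_rTrap_sub_sqrt_lt_of_lt`).

Mathlib has Cauchy's theorem for rectangles but no residue theorem for them; the case of finitely
many simple poles is `rectIntegral_eq_sum_residues`.
-/

namespace TrapSqrt

open Complex Set

/-! ### The residue theorem for rectangles -/

/-- The boundary of the rectangle `[p, q] × [c, d]`, as the closed rectangle without the open
one. -/
def rectFrame (p q c d : ℝ) : Set ℂ := (Icc p q ×ℂ Icc c d) \ (Ioo p q ×ℂ Ioo c d)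

section Frame

variable {p q c d : ℝ} {F G : ℂ → ℂ}

theorem horizontal_mem_rectFrame {t s : ℝ} (ht : t ∈ Icc p q) (hs : s ∈ Icc c d)
    (h : s = c ∨ s = d) : (t : ℂ) + (s : ℂ) * I ∈ rectFrame p q c d := by
  refine ⟨?_, ?_⟩
  · simpa [mem_reProdIm] using ⟨ht, hs⟩
  · intro h'
    simp only [mem_reProdIm, add_re, ofReal_re, mul_re, I_re, mul_zero, ofReal_im, I_im, mul_one,
      sub_self, add_zero, add_im, mul_im, zero_add, mem_Ioo] at h'
    rcases h with h | h <;> linarith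

theorem vertical_mem_rectFrame {t s : ℝ} (ht : t ∈ Icc p q) (hs : s ∈ Icc c d)
    (h : t = p ∨ t = q) : (t : ℂ) + (s : ℂ) * I ∈ rectFrame p q c d := by
  refine ⟨?_, ?_⟩
  · simpa [mem_reProdIm] using ⟨ht, hs⟩
  · intro h'
    simp only [mem_reProdIm, add_re, ofReal_re, mul_re, I_re, mul_zero, ofReal_im, I_im, mul_one,
      sub_self, add_zero, add_im, mul_im, zero_add, mem_Ioo] at h'
    rcases h with h | h <;> linarith

theorem intervalIntegrable_horizontal (hpq : p ≤ q) (hcd : c ≤ d)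
    (hF : ContinuousOn F (rectFrame p q c d)) {s : ℝ} (h : s = c ∨ s = d) :
    IntervalIntegrable (fun t : ℝ => F ((t : ℂ) + (s : ℂ) * I)) MeasureTheory.volume p q := by
  refine ContinuousOn.intervalIntegrable_of_Icc hpq (hF.comp (by fun_prop) ?_)
  intro t ht
  refine horizontal_mem_rectFrame ht ?_ h
  rcases h with rfl | rfl
  exacts [⟨le_rfl, hcd⟩, ⟨hcd, le_rfl⟩]

theorem intervalIntegrable_vertical (hpq : p ≤ q) (hcd : c ≤ d)
    (hF : ContinuousOn F (rectFrame p q c d)) {t : ℝ} (h : t = p ∨ t = q) :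
    IntervalIntegrable (fun s : ℝ => F ((t : ℂ) + (s : ℂ) * I)) MeasureTheory.volume c d := by
  refine ContinuousOn.intervalIntegrable_of_Icc hcd (hF.comp (by fun_prop) ?_)
  intro s hs
  refine vertical_mem_rectFrame ?_ hs h
  rcases h with rfl | rfl
  exacts [⟨le_rfl, hpq⟩, ⟨hpq, le_rfl⟩]

theorem rectIntegral_congr (hpq : p ≤ q) (hcd : c ≤ d) (h : EqOn F G (rectFrame p q c d)) :
    rectIntegral F p q c d = rectIntegral G p q c d := by
  have hp : p ∈ Icc p q := ⟨le_rfl, hpq⟩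
  have hq : q ∈ Icc p q := ⟨hpq, le_rfl⟩
  have hc : c ∈ Icc c d := ⟨le_rfl, hcd⟩
  have hd : d ∈ Icc c d := ⟨hcd, le_rfl⟩
  unfold rectIntegral
  congr 1
  · congr 1
    · congr 1
      · refine intervalIntegral.integral_congr fun t ht => h ?_
        rw [uIcc_of_le hpq] at ht
        exact horizontal_mem_rectFrame ht hc (.inl rfl)
      · congr 1
        refine intervalIntegral.integral_congr fun t ht => h ?_
        rw [uIcc_of_le hcd] at ht
        exact vertical_mem_rectFrame hq ht (.inr rfl)
    · refine intervalIntegral.integral_congr fun t ht => h ?_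
      rw [uIcc_of_le hpq] at ht
      exact horizontal_mem_rectFrame ht hd (.inr rfl)
  · congr 1
    refine intervalIntegral.integral_congr fun t ht => h ?_
    rw [uIcc_of_le hcd] at ht
    exact vertical_mem_rectFrame hp ht (.inl rfl)

theorem rectIntegral_add (hpq : p ≤ q) (hcd : c ≤ d) (hF : ContinuousOn F (rectFrame p q c d))
    (hG : ContinuousOn G (rectFrame p q c d)) :
    rectIntegral (fun u => F u + G u) p q c d =
      rectIntegral F p q c d + rectIntegral G p q c d := by
  unfold rectIntegral
  rw [intervalIntegral.integral_add (intervalIntegrable_horizontal hpq hcd hF (.inl rfl))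
      (intervalIntegrable_horizontal hpq hcd hG (.inl rfl)),
    intervalIntegral.integral_add (intervalIntegrable_horizontal hpq hcd hF (.inr rfl))
      (intervalIntegrable_horizontal hpq hcd hG (.inr rfl)),
    intervalIntegral.integral_add (intervalIntegrable_vertical hpq hcd hF (.inl rfl))
      (intervalIntegrable_vertical hpq hcd hG (.inl rfl)),
    intervalIntegral.integral_add (intervalIntegrable_vertical hpq hcd hF (.inr rfl))
      (intervalIntegrable_vertical hpq hcd hG (.inr rfl))]
  ring

theorem rectIntegral_const_mul (a : ℂ) :
    rectIntegral (fun u => a * F u) p q c d = a * rectIntegral F p q c d := by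
  unfold rectIntegral
  simp only [intervalIntegral.integral_const_mul]
  ring

theorem rectIntegral_eq_zero_of_differentiableOn (hpq : p ≤ q) (hcd : c ≤ d)
    (hF : DifferentiableOn ℂ F (Icc p q ×ℂ Icc c d)) : rectIntegral F p q c d = 0 := by
  have := Complex.integral_boundary_rect_eq_zero_of_differentiableOn F ⟨p, c⟩ ⟨q, d⟩
    (by simpa [uIcc_of_le hpq, uIcc_of_le hcd] using hF)
  simp only [smul_eq_mul] at this
  rw [← this, rectIntegral]
  ring

end Frame

theorem integral_inv_horizontal (a b : ℝ) {s : ℝ} (hs : s ≠ 0) :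
    ∫ t in a..b, ((t : ℂ) + s * I)⁻¹ = log (b + s * I) - log (a + s * I) := by
  have hne : ∀ t : ℝ, (t : ℂ) + s * I ∈ slitPlane := fun t => Or.inr (by simpa using hs)
  refine intervalIntegral.integral_eq_sub_of_hasDerivAt
    (f := fun t : ℝ => log ((t : ℂ) + s * I)) (fun t _ => ?_) ?_
  · have h1 : HasDerivAt (fun t : ℝ => (t : ℂ) + s * I) 1 t :=
      (ofRealCLM.hasDerivAt (x := t)).add_const _
    simpa using h1.clog_real (hne t)
  · refine ContinuousOn.intervalIntegrable (ContinuousOn.inv₀ (by fun_prop) ?_)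
    exact fun t _ => slitPlane_ne_zero (hne t)

theorem integral_inv_vertical (a b : ℝ) {t : ℝ} (ht : 0 < t) :
    I * ∫ s in a..b, ((t : ℂ) + s * I)⁻¹ = log (t + b * I) - log (t + a * I) := by
  have hne : ∀ s : ℝ, (t : ℂ) + s * I ∈ slitPlane := fun s => Or.inl (by simpa using ht)
  rw [← intervalIntegral.integral_const_mul]
  refine intervalIntegral.integral_eq_sub_of_hasDerivAt
    (f := fun s : ℝ => log ((t : ℂ) + s * I)) (fun s _ => ?_) ?_
  · have h1 : HasDerivAt (fun s : ℝ => (t : ℂ) + s * I) I s := by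
      simpa using ((ofRealCLM.hasDerivAt (x := s)).mul_const I).const_add (t : ℂ)
    simpa [div_eq_mul_inv] using h1.clog_real (hne s)
  · refine ContinuousOn.intervalIntegrable
      (continuousOn_const.mul (ContinuousOn.inv₀ (by fun_prop) ?_))
    exact fun s _ => slitPlane_ne_zero (hne s)

/-- On a vertical line in the left half plane `log (-z)` is a primitive of `1 / z`; the branch cut
of `log z` itself is crossed there. -/
theorem integral_inv_vertical_of_neg (a b : ℝ) {t : ℝ} (ht : t < 0) :
    I * ∫ s in a..b, ((t : ℂ) + s * I)⁻¹ = log (-(t + b * I)) - log (-(t + a * I)) := by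
  have h := integral_inv_vertical (-a) (-b) (neg_pos.2 ht)
  have h2 : ∫ s in (-a)..(-b), (((-t : ℝ) : ℂ) + s * I)⁻¹ = ∫ s in a..b, ((t : ℂ) + s * I)⁻¹ := by
    rw [intervalIntegral.integral_symm,
      ← intervalIntegral.integral_comp_neg (a := a) (b := b)
        (fun s : ℝ => (((-t : ℝ) : ℂ) + s * I)⁻¹),
      ← intervalIntegral.integral_neg]
    refine intervalIntegral.integral_congr fun s _ => ?_
    simp only [ofReal_neg]
    rw [← inv_neg]
    congr 1
    ring
  rw [h2] at h
  rw [h]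
  congr 2 <;> push_cast <;> ring

/-- The winding number of a rectangle around an interior point is one. -/
theorem rectIntegral_inv_sub {p q c d : ℝ} {w : ℂ} (hw : w ∈ Ioo p q ×ℂ Ioo c d) :
    rectIntegral (fun u => (u - w)⁻¹) p q c d = 2 * Real.pi * I := by
  obtain ⟨⟨hp, hq⟩, ⟨hc, hd⟩⟩ := hw
  have key : ∀ t s : ℝ, (t : ℂ) + s * I - w = ((t - w.re : ℝ) : ℂ) + ((s - w.im : ℝ) : ℂ) * I := by
    intro t s
    conv_lhs => rw [← re_add_im w]
    push_cast
    ring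
  unfold rectIntegral
  simp only [key]
  have hor : ∀ s : ℝ, ∫ t in p..q, (((t - w.re : ℝ) : ℂ) + ((s - w.im : ℝ) : ℂ) * I)⁻¹ =
      ∫ t in (p - w.re)..(q - w.re), ((t : ℂ) + ((s - w.im : ℝ) : ℂ) * I)⁻¹ := fun s =>
    intervalIntegral.integral_comp_sub_right
      (fun t : ℝ => ((t : ℂ) + ((s - w.im : ℝ) : ℂ) * I)⁻¹) w.re
  have ver : ∀ t : ℝ, ∫ s in c..d, (((t - w.re : ℝ) : ℂ) + ((s - w.im : ℝ) : ℂ) * I)⁻¹ =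
      ∫ s in (c - w.im)..(d - w.im), (((t - w.re : ℝ) : ℂ) + (s : ℂ) * I)⁻¹ := fun t =>
    intervalIntegral.integral_comp_sub_right
      (fun s : ℝ => (((t - w.re : ℝ) : ℂ) + (s : ℂ) * I)⁻¹) w.im
  rw [hor, hor, ver, ver, integral_inv_horizontal _ _ (by linarith),
    integral_inv_horizontal _ _ (by linarith : 0 < d - w.im).ne',
    integral_inv_vertical _ _ (by linarith), integral_inv_vertical_of_neg _ _ (by linarith)]
  have h1 : ∀ z : ℂ, 0 < z.im → log (-z) = log z - Real.pi * I := fun z hz => by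
    rw [log, log, arg_neg_eq_arg_sub_pi_of_im_pos hz, norm_neg]
    push_cast
    ring
  have h2 : ∀ z : ℂ, z.im < 0 → log (-z) = log z + Real.pi * I := fun z hz => by
    rw [log, log, arg_neg_eq_arg_add_pi_of_im_neg hz, norm_neg]
    push_cast
    ring
  rw [h1 _ (by simpa using hd), h2 _ (by simpa using hc)]
  ring

/-- The residue theorem for a rectangle and a function with finitely many simple poles, all of them
interior. The residue `r w` at a pole `w` is given as the limit of `(u - w) g(u)`. By induction on
the set of poles, the principal part of one of them being subtracted at each step. -/
theorem rectIntegral_eq_sum_residues {p q c d : ℝ} (S : Finset ℂ) (r : ℂ → ℂ) (g : ℂ → ℂ)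
    (hS : ∀ w ∈ S, w ∈ Ioo p q ×ℂ Ioo c d) (hpq : p ≤ q) (hcd : c ≤ d)
    (hg : ∀ u ∈ Icc p q ×ℂ Icc c d, u ∉ S → DifferentiableAt ℂ g u)
    (hr : ∀ w ∈ S, Tendsto (fun u => (u - w) * g u) (𝓝[≠] w) (𝓝 (r w))) :
    rectIntegral g p q c d = 2 * Real.pi * I * ∑ w ∈ S, r w := by
  classical
  induction S using Finset.induction_on generalizing g with
  | empty =>
    simp only [Finset.sum_empty, mul_zero]
    exact rectIntegral_eq_zero_of_differentiableOn hpq hcd fun u hu =>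
      (hg u hu (by simp)).differentiableWithinAt
  | insert w S hwS ih =>
    have hw := hS w (Finset.mem_insert_self _ _)
    have hopen : IsOpen (Ioo p q ×ℂ Ioo c d) := isOpen_Ioo.reProdIm isOpen_Ioo
    have hsub : Ioo p q ×ℂ Ioo c d ⊆ Icc p q ×ℂ Icc c d :=
      reProdIm_subset_iff.2 (prod_mono Ioo_subset_Icc_self Ioo_subset_Icc_self)
    set G : ℂ → ℂ := fun u => g u - r w * (u - w)⁻¹ with hG
    set L := limUnder (𝓝[≠] w) G
    have hGd : ∀ u, u ≠ w → DifferentiableAt ℂ g u → DifferentiableAt ℂ G u := fun u hu h =>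
      h.sub (((differentiableAt_id.sub_const w).inv (sub_ne_zero.2 hu)).const_mul _)
    -- `U` is a neighbourhood of `w` on which `w` is the only singularity.
    set U : Set ℂ := (Ioo p q ×ℂ Ioo c d) \ (S : Set ℂ)
    have hU : U ∈ 𝓝 w :=
      (hopen.sdiff S.finite_toSet.isClosed).mem_nhds ⟨hw, by simpa using hwS⟩
    have hlim0 : Tendsto (fun u => (u - w) * G u) (𝓝[≠] w) (𝓝 0) := by
      have h1 := (hr w (Finset.mem_insert_self _ _)).sub_const (r w)
      rw [sub_self] at h1
      refine h1.congr' ?_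
      filter_upwards [self_mem_nhdsWithin] with u hu
      have : u - w ≠ 0 := sub_ne_zero.2 hu
      simp only [hG]
      field_simp
    have hupd : DifferentiableOn ℂ (Function.update G w L) U := by
      refine Complex.differentiableOn_update_limUnder_of_isLittleO hU ?_ ?_
      · rintro u ⟨⟨huR, huS⟩, huw⟩
        refine (hGd u huw (hg u (hsub huR) ?_)).differentiableWithinAt
        simp only [Finset.mem_insert, not_or]
        exact ⟨huw, by simpa using huS⟩
      · have h2 : Tendsto (fun u => (u - w) * (G u - G w)) (𝓝[≠] w) (𝓝 0) := by
          have h3 : Tendsto (fun u : ℂ => (u - w) * G w) (𝓝[≠] w) (𝓝 0) := by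
            have : ContinuousAt (fun u : ℂ => (u - w) * G w) w := by fun_prop
            simpa using this.tendsto.mono_left nhdsWithin_le_nhds
          simpa [mul_sub] using hlim0.sub h3
        refine (Asymptotics.isLittleO_iff_tendsto' ?_).2 (h2.congr fun u => ?_)
        · filter_upwards [self_mem_nhdsWithin] with u hu h0
          exact absurd h0 (inv_ne_zero (sub_ne_zero.2 hu))
        · rw [div_inv_eq_mul, mul_comm]
    have hupd_eq : ∀ u, u ≠ w → Function.update G w L =ᶠ[𝓝 u] G := fun u hu => by
      filter_upwards [isOpen_ne.mem_nhds hu] with v hv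
      exact Function.update_of_ne hv _ _
    have hne_frame : ∀ u ∈ rectFrame p q c d, u ≠ w := fun u hu h => hu.2 (h ▸ hw)
    have hrec := ih (Function.update G w L) (fun v hv => hS v (Finset.mem_insert_of_mem hv))
      (fun u hu huS => by
        rcases eq_or_ne u w with rfl | huw
        · exact hupd.differentiableAt hU
        · refine ((hGd u huw (hg u hu ?_))).congr_of_eventuallyEq (hupd_eq u huw)
          simp [huw, huS])
      (fun v hv => by
        have hvw : v ≠ w := fun h => hwS (h ▸ hv)
        have h1 := hr v (Finset.mem_insert_of_mem hv)
        have h2 : Tendsto (fun u => (u - v) * (r w * (u - w)⁻¹)) (𝓝[≠] v) (𝓝 0) := by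
          have : ContinuousAt (fun u => (u - v) * (r w * (u - w)⁻¹)) v := by
            have := sub_ne_zero.2 hvw
            fun_prop (disch := assumption)
          simpa using this.tendsto.mono_left nhdsWithin_le_nhds
        have h3 := h1.sub h2
        rw [sub_zero] at h3
        refine h3.congr' ?_
        filter_upwards [(hupd_eq v hvw).filter_mono nhdsWithin_le_nhds] with u hu
        rw [hu]
        simp only [hG]
        ring)
    have hcongr : EqOn g (fun u => Function.update G w L u + r w * (u - w)⁻¹)
        (rectFrame p q c d) := fun u hu => by
      simp only [Function.update_of_ne (hne_frame u hu), hG]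
      ring
    have hdg : ∀ u ∈ rectFrame p q c d, DifferentiableAt ℂ g u := fun u hu =>
      hg u hu.1 fun h => hu.2 (hS u h)
    rw [rectIntegral_congr hpq hcd hcongr, rectIntegral_add hpq hcd, hrec,
      rectIntegral_const_mul, rectIntegral_inv_sub hw, Finset.sum_insert hwS]
    · ring
    · intro u hu
      exact ((hGd u (hne_frame u hu) (hdg u hu)).congr_of_eventuallyEq
        (hupd_eq u (hne_frame u hu))).continuousAt.continuousWithinAt
    · intro u hu
      have := sub_ne_zero.2 (hne_frame u hu)
      exact ContinuousAt.continuousWithinAt (by fun_prop (disch := assumption))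

/-- The residue of a quotient at a simple zero of the denominator. -/
theorem tendsto_sub_mul_div {n D : ℂ → ℂ} {w D' : ℂ} (hn : ContinuousAt n w)
    (hD : HasDerivAt D D' w) (h0 : D w = 0) (hD' : D' ≠ 0) :
    Tendsto (fun u => (u - w) * (n u / D u)) (𝓝[≠] w) (𝓝 (n w / D')) := by
  have h1 := (hasDerivAt_iff_tendsto_slope.1 hD).inv₀ hD'
  have h2 := (hn.tendsto.mono_left nhdsWithin_le_nhds).mul h1
  rw [← div_eq_mul_inv] at h2
  refine h2.congr fun u => ?_
  rw [slope_def_field, h0, sub_zero, inv_div]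
  ring

/-! ### The contour formula for the quadrature error -/

/-- Integration of the jump function `charMu` across the real axis. -/
theorem integral_mul_charMu_add {φ γ : ℝ → ℂ} {a t : ℝ} (ha : 0 ≤ a)
    (hφ : IntervalIntegrable φ MeasureTheory.volume (-a) a)
    (hγ : IntervalIntegrable γ MeasureTheory.volume (-a) a) :
    ∫ s in (-a)..a, (φ s * charMu ((t : ℂ) + (s : ℂ) * I) + γ s) =
      1 / 2 * (∫ s in (-a)..0, φ s) - 1 / 2 * (∫ s in 0..a, φ s) + ∫ s in (-a)..a, γ s := by
  have ha' : -a ≤ 0 := neg_nonpos.2 ha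
  have hlow : EqOn (fun s : ℝ => 1 / 2 * φ s)
      (fun s : ℝ => φ s * charMu ((t : ℂ) + (s : ℂ) * I)) (uIoo (-a) 0) := fun s hs => by
    rw [uIoo_of_le ha'] at hs
    simp [charMu, hs.2, mul_comm]
  have hup : EqOn (fun s : ℝ => -(1 / 2) * φ s)
      (fun s : ℝ => φ s * charMu ((t : ℂ) + (s : ℂ) * I)) (uIoo 0 a) := fun s hs => by
    rw [uIoo_of_le ha] at hs
    simp [charMu, hs.1.le, mul_comm]
  have hφ1 : IntervalIntegrable φ MeasureTheory.volume (-a) 0 :=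
    hφ.mono_set (by rw [uIcc_of_le ha', uIcc_of_le (ha'.trans ha)]; exact Icc_subset_Icc_right ha)
  have hφ2 : IntervalIntegrable φ MeasureTheory.volume 0 a :=
    hφ.mono_set (by rw [uIcc_of_le ha, uIcc_of_le (ha'.trans ha)]; exact Icc_subset_Icc_left ha')
  have h1 := (hφ1.const_mul (1 / 2)).congr_uIoo hlow
  have h2 := (hφ2.const_mul (-(1 / 2))).congr_uIoo hup
  rw [intervalIntegral.integral_add (h1.trans h2) hγ,
    ← intervalIntegral.integral_add_adjacent_intervals h1 h2,
    ← intervalIntegral.integral_congr_uIoo hlow, ← intervalIntegral.integral_congr_uIoo hup,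
    intervalIntegral.integral_const_mul, intervalIntegral.integral_const_mul]
  ring

/-- The factor `charMu` splits a contour integral into one over the lower and one over the upper
half of the rectangle. The integral over the common side on the real axis is what the two
half-contours have in excess. -/
theorem rectIntegral_mul_charMu_add {f g : ℂ → ℂ} {p q a : ℝ} (hpq : p ≤ q) (ha : 0 < a)
    (hf : ContinuousOn f (rectFrame p q (-a) a)) (hg : ContinuousOn g (rectFrame p q (-a) a)) :
    rectIntegral (fun u => f u * charMu u + g u) p q (-a) a =
      rectIntegral g p q (-a) a + 1 / 2 * rectIntegral f p q (-a) 0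
        - 1 / 2 * rectIntegral f p q 0 a + ∫ t in p..q, f t := by
  have hle : -a ≤ a := by linarith
  have hlow : ∀ t : ℝ, charMu ((t : ℂ) + ((-a : ℝ) : ℂ) * I) = 1 / 2 := fun t => by
    simp [charMu, ha]
  have hup : ∀ t : ℝ, charMu ((t : ℂ) + ((a : ℝ) : ℂ) * I) = -(1 / 2) := fun t => by
    simp [charMu, ha.le]
  unfold rectIntegral
  rw [integral_mul_charMu_add ha.le (intervalIntegrable_vertical hpq hle hf (.inl rfl))
      (intervalIntegrable_vertical hpq hle hg (.inl rfl)),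
    integral_mul_charMu_add ha.le (intervalIntegrable_vertical hpq hle hf (.inr rfl))
      (intervalIntegrable_vertical hpq hle hg (.inr rfl))]
  simp only [hlow, hup]
  rw [intervalIntegral.integral_add
      ((intervalIntegrable_horizontal hpq hle hf (.inl rfl)).mul_const _)
      (intervalIntegrable_horizontal hpq hle hg (.inl rfl)),
    intervalIntegral.integral_add
      ((intervalIntegrable_horizontal hpq hle hf (.inr rfl)).mul_const _)
      (intervalIntegrable_horizontal hpq hle hg (.inr rfl))]
  simp only [intervalIntegral.integral_mul_const, ofReal_zero, zero_mul, add_zero]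
  ring

theorem sin_pi_mul_div_eq_zero_iff {h : ℝ} (hh : h ≠ 0) {u : ℂ} :
    sin ((Real.pi : ℂ) * u / (h : ℂ)) = 0 ↔ ∃ k : ℤ, u = k * h := by
  have hh' : (h : ℂ) ≠ 0 := ofReal_ne_zero.2 hh
  have hpi : (Real.pi : ℂ) ≠ 0 := ofReal_ne_zero.2 Real.pi_ne_zero
  rw [sin_eq_zero_iff]
  refine exists_congr fun k => ?_
  rw [div_eq_iff hh', show (k : ℂ) * Real.pi * h = Real.pi * (k * h) by ring,
    mul_right_inj' hpi]

theorem differentiableAt_cot_pi_mul_div {h : ℝ} {u : ℂ}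
    (hu : sin ((Real.pi : ℂ) * u / (h : ℂ)) ≠ 0) :
    DifferentiableAt ℂ (fun u : ℂ => cot ((Real.pi : ℂ) * u / (h : ℂ))) u := by
  simp only [cot_eq_cos_div_sin]
  fun_prop (disch := assumption)

/-- The residue of `f(u) (i/2) cot(π u / h)` at a node `k h`. -/
theorem tendsto_sub_mul_cot {h : ℝ} (hh : h ≠ 0) {f : ℂ → ℂ} (k : ℕ)
    (hf : ContinuousAt f (k * h)) :
    Tendsto (fun u : ℂ => (u - k * h) * (f u * (I / 2 * cot ((Real.pi : ℂ) * u / (h : ℂ)))))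
      (𝓝[≠] (k * h : ℂ)) (𝓝 (f (k * h) * (I / 2) * (h / Real.pi))) := by
  have hh' : (h : ℂ) ≠ 0 := ofReal_ne_zero.2 hh
  have hpi : (Real.pi : ℂ) ≠ 0 := ofReal_ne_zero.2 Real.pi_ne_zero
  have hsin : sin ((Real.pi : ℂ) * (k * h) / h) = 0 :=
    (sin_pi_mul_div_eq_zero_iff hh).2 ⟨k, by simp⟩
  have hcos : cos ((Real.pi : ℂ) * (k * h) / h) ≠ 0 := fun h0 => by
    have := sin_sq_add_cos_sq ((Real.pi : ℂ) * (k * h) / h)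
    simp [hsin, h0] at this
  have hD : HasDerivAt (fun u : ℂ => sin ((Real.pi : ℂ) * u / h))
      (cos ((Real.pi : ℂ) * (k * h) / h) * (Real.pi / h)) (k * h) := by
    have := (((hasDerivAt_id (k * h : ℂ)).const_mul (Real.pi : ℂ)).div_const (h : ℂ)).csin
    simpa using this
  have hn : ContinuousAt (fun u : ℂ => f u * (I / 2) * cos ((Real.pi : ℂ) * u / h)) (k * h) :=
    (hf.mul continuousAt_const).mul (by fun_prop)
  have := tendsto_sub_mul_div hn hD hsin (mul_ne_zero hcos (div_ne_zero hpi hh'))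
  convert this using 2
  · rw [cot_eq_cos_div_sin]; ring
  · generalize cos ((Real.pi : ℂ) * (k * h) / h) = y at hcos
    field_simp

theorem sin_pi_mul_div_ne_zero_of_im_ne_zero {h : ℝ} (hh : h ≠ 0) {u : ℂ} (hu : u.im ≠ 0) :
    sin ((Real.pi : ℂ) * u / (h : ℂ)) ≠ 0 := by
  rw [Ne, sin_pi_mul_div_eq_zero_iff hh]
  rintro ⟨k, rfl⟩
  simp at hu

/-- The error of the quadrature rule with nodes `h, 2h, …, N h` as a contour integral with weight
`charDelta`. The function `f` may have one simple pole in each of the two halves of the rectangle;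
`r₁`, `r₂` are the residues of `f` there. -/
theorem rectIntegral_mul_charDelta {f : ℂ → ℂ} {h p q a : ℝ} {N : ℕ} {w₁ w₂ r₁ r₂ : ℂ}
    (hp : 0 < p) (hph : p < h) (hNq : N * h < q) (hqN : q < (N + 1) * h) (hpq : p ≤ q) (ha : 0 < a)
    (hw₁ : w₁ ∈ Ioo p q ×ℂ Ioo 0 a) (hw₂ : w₂ ∈ Ioo p q ×ℂ Ioo (-a) 0)
    (hf : ∀ u ∈ Icc p q ×ℂ Icc (-a) a, u ≠ w₁ → u ≠ w₂ → DifferentiableAt ℂ f u)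
    (hr₁ : Tendsto (fun u => (u - w₁) * f u) (𝓝[≠] w₁) (𝓝 r₁))
    (hr₂ : Tendsto (fun u => (u - w₂) * f u) (𝓝[≠] w₂) (𝓝 r₂)) :
    rectIntegral (fun u => f u * charDelta h u) p q (-a) a =
      (∫ t in p..q, f t) - h * ∑ j ∈ Finset.Icc 1 N, f (j * h) +
        2 * Real.pi * I * (r₁ * charDelta h w₁ + r₂ * charDelta h w₂) := by
  classical
  have hh : 0 < h := hp.trans hph
  have him₁ : 0 < w₁.im := hw₁.2.1
  have him₂ : w₂.im < 0 := hw₂.2.2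
  have hw : w₁ ≠ w₂ := fun h => by rw [h] at him₁; linarith
  have hmem₁ : w₁ ∈ Ioo p q ×ℂ Ioo (-a) a := ⟨hw₁.1, by linarith, hw₁.2.2⟩
  have hmem₂ : w₂ ∈ Ioo p q ×ℂ Ioo (-a) a := ⟨hw₂.1, hw₂.2.1, by linarith⟩
  set node : ℕ → ℂ := fun j => (j : ℂ) * h with hnode
  have node_im : ∀ j, (node j).im = 0 := fun j => by simp [hnode]
  have node_re : ∀ j, (node j).re = j * h := fun j => by simp [hnode]
  have node_mem : ∀ j ∈ Finset.Icc 1 N, node j ∈ Ioo p q ×ℂ Ioo (-a) a := fun j hj => by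
    obtain ⟨h1, h2⟩ := Finset.mem_Icc.1 hj
    have h1' : (1 : ℝ) ≤ j := by exact_mod_cast h1
    have h2' : (j : ℝ) ≤ N := by exact_mod_cast h2
    refine ⟨?_, ?_⟩
    · rw [mem_preimage, node_re]
      constructor <;> nlinarith
    · rw [mem_preimage, node_im]
      constructor <;> linarith
  have node_ne₁ : ∀ j, node j ≠ w₁ := fun j h => by
    have := node_im j; rw [h] at this; linarith
  have node_ne₂ : ∀ j, node j ≠ w₂ := fun j h => by
    have := node_im j; rw [h] at this; linarith
  have node_inj : Function.Injective node := fun i j hij => by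
    have := congrArg re hij
    rw [node_re, node_re] at this
    exact_mod_cast mul_right_cancel₀ hh.ne' this
  have hsub : Ioo p q ×ℂ Ioo (-a) a ⊆ Icc p q ×ℂ Icc (-a) a :=
    reProdIm_subset_iff.2 (prod_mono Ioo_subset_Icc_self Ioo_subset_Icc_self)
  set k : ℂ → ℂ := fun u => I / 2 * cot ((Real.pi : ℂ) * u / (h : ℂ)) with hk
  have hkd : ∀ u : ℂ, sin ((Real.pi : ℂ) * u / (h : ℂ)) ≠ 0 → DifferentiableAt ℂ k u :=
    fun u hu => (differentiableAt_cot_pi_mul_div hu).const_mul _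
  set S : Finset ℂ := insert w₁ (insert w₂ ((Finset.Icc 1 N).image node)) with hS
  set r : ℂ → ℂ := fun u => if u = w₁ then r₁ * k w₁ else if u = w₂ then r₂ * k w₂ else
    f u * (I / 2) * (h / Real.pi) with hr
  have hSin : ∀ w ∈ S, w ∈ Ioo p q ×ℂ Ioo (-a) a := fun w hwS => by
    rw [hS, Finset.mem_insert, Finset.mem_insert, Finset.mem_image] at hwS
    rcases hwS with rfl | rfl | ⟨j, hj, rfl⟩
    exacts [hmem₁, hmem₂, node_mem j hj]
  have hgd : ∀ u ∈ Icc p q ×ℂ Icc (-a) a, u ∉ S →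
      DifferentiableAt ℂ (fun u => f u * k u) u := fun u hu huS => by
    rw [hS, Finset.mem_insert, Finset.mem_insert, Finset.mem_image] at huS
    push Not at huS
    refine (hf u hu huS.1 huS.2.1).mul (hkd u ?_)
    rw [Ne, sin_pi_mul_div_eq_zero_iff hh.ne']
    rintro ⟨m, rfl⟩
    have hre : p ≤ m * h ∧ m * h ≤ q := by simpa using hu.1
    -- a node in the strip `p ≤ Re u ≤ q` has index between `1` and `N`
    have hm1 : (0 : ℝ) < m := by
      by_contra hcon
      nlinarith [hre.1]
    have hm2 : (m : ℝ) < N + 1 := by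
      by_contra hcon
      nlinarith [hre.2]
    have hm1' : 0 < m := by exact_mod_cast hm1
    have hm2' : m < N + 1 := by exact_mod_cast hm2
    lift m to ℕ using hm1'.le
    exact huS.2.2 m (Finset.mem_Icc.2 ⟨by omega, by omega⟩) (by simp [hnode])
  have hcot := rectIntegral_eq_sum_residues S r (fun u => f u * k u) hSin hpq (by linarith) hgd
    (fun w hwS => by
      rw [hS, Finset.mem_insert, Finset.mem_insert, Finset.mem_image] at hwS
      rcases hwS with rfl | rfl | ⟨j, hj, rfl⟩
      · simp only [hr, if_true]
        have hkw := hkd w (sin_pi_mul_div_ne_zero_of_im_ne_zero hh.ne' him₁.ne')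
        exact (hr₁.mul (hkw.continuousAt.mono_left nhdsWithin_le_nhds)).congr fun u => by ring
      · simp only [hr, if_true, hw.symm, if_false]
        have hkw := hkd w (sin_pi_mul_div_ne_zero_of_im_ne_zero hh.ne' him₂.ne)
        exact (hr₂.mul (hkw.continuousAt.mono_left nhdsWithin_le_nhds)).congr fun u => by ring
      · simp only [hr, node_ne₁, node_ne₂, if_false]
        exact tendsto_sub_mul_cot hh.ne' j
          (hf _ (hsub (node_mem j hj)) (node_ne₁ j) (node_ne₂ j)).continuousAt)
  have hnotin₂ : w₂ ∉ (Finset.Icc 1 N).image node := fun hmem => by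
    obtain ⟨j, -, hj⟩ := Finset.mem_image.1 hmem
    exact node_ne₂ j hj
  have hnotin₁ : w₁ ∉ insert w₂ ((Finset.Icc 1 N).image node) := fun hmem => by
    rcases Finset.mem_insert.1 hmem with hmem | hmem
    · exact hw hmem
    · obtain ⟨j, -, hj⟩ := Finset.mem_image.1 hmem
      exact node_ne₁ j hj
  have hsum : ∑ w ∈ S, r w =
      r₁ * k w₁ + r₂ * k w₂ + (∑ j ∈ Finset.Icc 1 N, f (j * h)) * (I / 2) * (h / Real.pi) := by
    rw [hS, Finset.sum_insert hnotin₁, Finset.sum_insert hnotin₂,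
      Finset.sum_image node_inj.injOn, Finset.sum_mul, Finset.sum_mul, add_assoc]
    simp only [hr, if_true, hw.symm, if_false, node_ne₁, node_ne₂]
    rfl
  have hup : rectIntegral f p q 0 a = 2 * Real.pi * I * r₁ := by
    have := rectIntegral_eq_sum_residues {w₁} (fun _ => r₁) f (p := p) (q := q) (c := 0) (d := a)
      (by simpa using hw₁) hpq ha.le
      (fun u hu hu1 => hf u ⟨hu.1, by linarith [hu.2.1], hu.2.2⟩ (by simpa using hu1)
        (fun h => by have := hu.2.1; rw [h] at this; linarith))
      (by simpa using hr₁)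
    simpa using this
  have hlow : rectIntegral f p q (-a) 0 = 2 * Real.pi * I * r₂ := by
    have := rectIntegral_eq_sum_residues {w₂} (fun _ => r₂) f (p := p) (q := q) (c := -a) (d := 0)
      (by simpa using hw₂) hpq (by linarith)
      (fun u hu hu1 => hf u ⟨hu.1, hu.2.1, by linarith [hu.2.2]⟩
        (fun h => by have := hu.2.2; rw [h] at this; linarith) (by simpa using hu1))
      (by simpa using hr₂)
    simpa using this
  have hdelta : ∀ u, charDelta h u = charMu u + k u := fun u => by
    simp only [charDelta, charM, hk]; ring
  have hframe : ∀ u ∈ rectFrame p q (-a) a, u ∉ S := fun u hu huS => hu.2 (hSin u huS)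
  have hfc : ContinuousOn f (rectFrame p q (-a) a) := fun u hu =>
    (hf u hu.1 (fun h => hu.2 (h ▸ hmem₁))
      (fun h => hu.2 (h ▸ hmem₂))).continuousAt.continuousWithinAt
  have hgc : ContinuousOn (fun u => f u * k u) (rectFrame p q (-a) a) := fun u hu =>
    (hgd u hu.1 (hframe u hu)).continuousAt.continuousWithinAt
  have hμ₁ : charMu w₁ = -(1 / 2) := by simp [charMu, him₁.le]
  have hμ₂ : charMu w₂ = 1 / 2 := by simp [charMu, him₂]
  have hpi : (Real.pi : ℂ) ≠ 0 := ofReal_ne_zero.2 Real.pi_ne_zero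
  simp only [hdelta, mul_add]
  rw [rectIntegral_mul_charMu_add hpq ha hfc hgc, hcot, hsum, hup, hlow, hμ₁, hμ₂]
  have hsq : 2 * (Real.pi : ℂ) * I * ((∑ j ∈ Finset.Icc 1 N, f (j * h)) * (I / 2) * (h / Real.pi)) =
      -(h * ∑ j ∈ Finset.Icc 1 N, f (j * h)) := by
    field_simp
    rw [I_sq]
    ring_nf
  linear_combination hsq

/-- In the upper half plane `charDelta` is `e^{2iz} / (1 - e^{2iz})` with `z = π u / h`, hence
exponentially small. -/
theorem norm_neg_half_add_cot_le {z : ℂ} (hz : 0 < z.im) :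
    ‖-(1 / 2) + I / 2 * cot z‖ ≤ Real.exp (-2 * z.im) / (1 - Real.exp (-2 * z.im)) := by
  set e := exp (2 * I * z) with he
  have hnorm : ‖e‖ = Real.exp (-2 * z.im) := by
    rw [he, norm_exp]
    congr 1
    simp
  have hlt : ‖e‖ < 1 := by
    rw [hnorm, Real.exp_lt_one_iff]
    linarith
  have hne : 1 - e ≠ 0 := fun h0 => by
    have : e = 1 := (sub_eq_zero.1 h0).symm
    simp [this] at hlt
  have heq : -(1 / 2) + I / 2 * cot z = e / (1 - e) := by
    rw [cot_eq_exp_ratio, ← he]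
    field_simp
    ring
  rw [heq, norm_div, ← hnorm]
  have h1 : 1 - ‖e‖ ≤ ‖1 - e‖ := by
    have := norm_sub_norm_le (1 : ℂ) e
    simpa using this
  gcongr

theorem norm_charDelta_le {h : ℝ} (hh : 0 < h) {u : ℂ} (hu : u.im ≠ 0) :
    ‖charDelta h u‖ ≤
      Real.exp (-2 * (Real.pi * |u.im| / h)) / (1 - Real.exp (-2 * (Real.pi * |u.im| / h))) := by
  have him : ((Real.pi : ℂ) * u / (h : ℂ)).im = Real.pi * u.im / h := by
    rw [div_ofReal_im, im_ofReal_mul]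
  rcases lt_or_gt_of_ne hu with hneg | hpos
  · have hz : 0 < (-((Real.pi : ℂ) * u / (h : ℂ))).im := by
      rw [neg_im, him, ← neg_div, ← mul_neg]
      exact div_pos (mul_pos Real.pi_pos (neg_pos.2 hneg)) hh
    have := norm_neg_half_add_cot_le hz
    rw [neg_im, him, cot_eq_cos_div_sin, cos_neg, sin_neg, div_neg, ← cot_eq_cos_div_sin,
      show -(Real.pi * u.im / h) = Real.pi * |u.im| / h by
      rw [abs_of_neg hneg]; ring] at this
    convert this using 1
    rw [← norm_neg]
    simp only [charDelta, charM, charMu, not_le.2 hneg, if_false]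
    congr 1
    ring
  · have hz : 0 < ((Real.pi : ℂ) * u / (h : ℂ)).im := by
      rw [him]
      exact div_pos (mul_pos Real.pi_pos hpos) hh
    have := norm_neg_half_add_cot_le hz
    rw [him] at this
    rw [abs_of_pos hpos]
    convert this using 1
    simp only [charDelta, charM, charMu, hpos.le, if_true]
    congr 1
    ring

/-! ### The integrand and its poles -/

theorem sqrt_sq_of_re_pos {v : ℂ} (hv : 0 < v.re) : Complex.sqrt (v ^ 2) = v :=
  sq_cpow_two_inv hv

theorem sq_sqrt (u : ℂ) : Complex.sqrt u ^ 2 = u :=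
  cpow_ofNat_inv_pow u 2

theorem sqrt_re_pos {u : ℂ} (hu : 0 < u.re) : 0 < (Complex.sqrt u).re := by
  rw [Complex.sqrt, cpow_inv_two_re]
  exact Real.sqrt_pos.2 (by positivity)

theorem sqrt_ne_zero {u : ℂ} (hu : 0 < u.re) : Complex.sqrt u ≠ 0 := fun h => by
  have := sqrt_re_pos hu
  simp [h] at this

theorem hasDerivAt_sqrt_of_re_pos {u : ℂ} (hu : 0 < u.re) :
    HasDerivAt Complex.sqrt (1 / (2 * Complex.sqrt u)) u := by
  refine (hasDerivAt_sqrt (.inl hu)).congr_deriv ?_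
  rw [neg_div, cpow_neg, one_div, Complex.sqrt]
  field_simp

/-- The numerator of `integrand`. -/
noncomputable def integrandNum (T x : ℝ) (u : ℂ) : ℂ :=
  (x : ℂ) / (Real.pi : ℂ) * (1 / Complex.sqrt u) * exp (Complex.sqrt u - (T : ℂ))

/-- The denominator of `integrand`. -/
noncomputable def integrandDen (T x : ℝ) (u : ℂ) : ℂ :=
  exp (2 * (Complex.sqrt u - (T : ℂ))) + (x : ℂ)

theorem integrand_eq_div (T x : ℝ) (u : ℂ) :
    integrand T x u = integrandNum T x u / integrandDen T x u := by
  rw [integrand, integrandNum, integrandDen, mul_div_assoc]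

theorem differentiableAt_integrandNum (T x : ℝ) {u : ℂ} (hu : 0 < u.re) :
    DifferentiableAt ℂ (integrandNum T x) u := by
  have h1 := (hasDerivAt_sqrt_of_re_pos hu).differentiableAt
  have h2 := sqrt_ne_zero hu
  unfold integrandNum
  fun_prop (disch := assumption)

theorem hasDerivAt_integrandDen (T x : ℝ) {u : ℂ} (hu : 0 < u.re) :
    HasDerivAt (integrandDen T x)
      (exp (2 * (Complex.sqrt u - (T : ℂ))) * (2 * (1 / (2 * Complex.sqrt u)))) u :=
  ((((hasDerivAt_sqrt_of_re_pos hu).sub_const (T : ℂ)).const_mul 2).cexp).add_const (x : ℂ)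

theorem differentiableAt_integrand (T x : ℝ) {u : ℂ} (hu : 0 < u.re)
    (h : integrandDen T x u ≠ 0) : DifferentiableAt ℂ (integrand T x) u := by
  have : integrand T x = fun u => integrandNum T x u / integrandDen T x u :=
    funext (integrand_eq_div T x)
  rw [this]
  exact (differentiableAt_integrandNum T x hu).div
    (hasDerivAt_integrandDen T x hu).differentiableAt h

/-- The residue of the integrand at a pole `v²`, where `v` is a zero of `e^{2(v - T)} + x`. -/
theorem tendsto_sub_mul_integrand {T x : ℝ} (hx : 0 < x) {v : ℂ} (hv : 0 < v.re)
    (hv2 : 0 < (v ^ 2).re) (hzero : exp (2 * (v - T)) = -x) :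
    Tendsto (fun u => (u - v ^ 2) * integrand T x u) (𝓝[≠] (v ^ 2))
      (𝓝 (-(exp (v - T) / Real.pi))) := by
  have hsqrt := sqrt_sq_of_re_pos hv
  have hv0 : v ≠ 0 := fun h => by simp [h] at hv
  have hx' : (x : ℂ) ≠ 0 := ofReal_ne_zero.2 hx.ne'
  have hpi : (Real.pi : ℂ) ≠ 0 := ofReal_ne_zero.2 Real.pi_ne_zero
  have hD := hasDerivAt_integrandDen T x hv2
  rw [hsqrt, hzero] at hD
  have := tendsto_sub_mul_div (differentiableAt_integrandNum T x hv2).continuousAt hD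
    (by rw [integrandDen, hsqrt, hzero]; ring)
    (mul_ne_zero (neg_ne_zero.2 hx') (by simp [hv0]))
  convert this using 2
  · rw [integrand_eq_div]
  · rw [integrandNum, hsqrt]
    field_simp

theorem exp_add_mul_half_pi_mul_I_sub (T x : ℝ) (hx : 0 < x) (σ : ℂ) :
    exp (((T + Real.log x / 2 : ℝ) : ℂ) + σ * (Real.pi / 2 * I) - T) =
      Real.sqrt x * exp (σ * (Real.pi / 2 * I)) := by
  rw [show ((T + Real.log x / 2 : ℝ) : ℂ) + σ * (Real.pi / 2 * I) - T =
      ((Real.log x / 2 : ℝ) : ℂ) + σ * (Real.pi / 2 * I) by push_cast; ring, exp_add,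
    ← ofReal_exp, ← Real.log_sqrt hx.le, Real.exp_log (Real.sqrt_pos.2 hx)]

/-- The pole `(b ± iπ/2)²`, where `b = T + (log x) / 2`, for the sign `σ = ±1`. -/
noncomputable def pole (T x σ : ℝ) : ℂ :=
  (((T + Real.log x / 2 : ℝ) : ℂ) + σ * (Real.pi / 2 * I)) ^ 2

theorem pole_re (T x σ : ℝ) :
    (pole T x σ).re = (T + Real.log x / 2) ^ 2 - (σ * (Real.pi / 2)) ^ 2 := by
  rw [pole, show (Real.pi / 2 * I : ℂ) = ((Real.pi / 2 : ℝ) : ℂ) * I by push_cast; ring,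
    ← mul_assoc, ← ofReal_mul, sq, mul_re]
  simp only [add_re, add_im, ofReal_re, ofReal_im, re_ofReal_mul, im_ofReal_mul, I_re, I_im]
  ring

theorem pole_im (T x σ : ℝ) :
    (pole T x σ).im = σ * Real.pi * (T + Real.log x / 2) := by
  rw [pole, show (Real.pi / 2 * I : ℂ) = ((Real.pi / 2 : ℝ) : ℂ) * I by push_cast; ring,
    ← mul_assoc, ← ofReal_mul, sq, mul_im]
  simp only [add_re, add_im, ofReal_re, ofReal_im, re_ofReal_mul, im_ofReal_mul, I_re, I_im]
  ring

theorem tendsto_sub_mul_integrand_pole {T x σ : ℝ} (hx : 0 < x) (hσ : σ = 1 ∨ σ = -1)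
    (hb : 0 < T + Real.log x / 2) (hre : 0 < (pole T x σ).re) :
    Tendsto (fun u => (u - pole T x σ) * integrand T x u) (𝓝[≠] (pole T x σ))
      (𝓝 (-(σ * (Real.sqrt x * I / Real.pi)))) := by
  have hexp : exp (σ * (Real.pi / 2 * I)) = σ * I := by
    rcases hσ with rfl | rfl
    · simp [exp_pi_div_two_mul_I]
    · rw [show ((-1 : ℝ) : ℂ) * (Real.pi / 2 * I) = -Real.pi / 2 * I by push_cast; ring,
        exp_neg_pi_div_two_mul_I]
      simp
  have h1 : exp (((T + Real.log x / 2 : ℝ) : ℂ) + σ * (Real.pi / 2 * I) - T) =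
      Real.sqrt x * (σ * I) := by
    rw [exp_add_mul_half_pi_mul_I_sub T x hx, hexp]
  have hσ2 : (σ : ℂ) ^ 2 = 1 := by rcases hσ with rfl | rfl <;> simp
  have h2 : exp (2 * (((T + Real.log x / 2 : ℝ) : ℂ) + σ * (Real.pi / 2 * I) - T)) = -x := by
    have hsq : (Real.sqrt x : ℂ) ^ 2 = x := by exact_mod_cast Real.sq_sqrt hx.le
    rw [two_mul, exp_add, h1]
    linear_combination (σ : ℂ) ^ 2 * I ^ 2 * hsq + x * I ^ 2 * hσ2 + x * I_sq
  have hre' : 0 < (((T + Real.log x / 2 : ℝ) : ℂ) + σ * (Real.pi / 2 * I)).re := by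
    rw [show (σ : ℂ) * (Real.pi / 2 * I) = ((σ * (Real.pi / 2) : ℝ) : ℂ) * I by push_cast; ring,
      add_re, ofReal_re, re_ofReal_mul, I_re, mul_zero, add_zero]
    exact hb
  have := tendsto_sub_mul_integrand hx hre' hre h2
  rw [h1, show (Real.sqrt x : ℂ) * (σ * I) / Real.pi = σ * (Real.sqrt x * I / Real.pi) by
    ring] at this
  exact this

/-- In the strip `|Im u| ≤ 2π b`, where `b = T + (log x) / 2`, the integrand has no other poles than
the two points `pole T x (±1)`; the next ones have imaginary part `±3π b`. -/
theorem eq_pole_of_integrandDen_eq_zero {T x : ℝ} (hx : 0 < x) (hb : 0 < T + Real.log x / 2)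
    {u : ℂ} (him : |u.im| ≤ 2 * Real.pi * (T + Real.log x / 2))
    (h : integrandDen T x u = 0) : u = pole T x 1 ∨ u = pole T x (-1) := by
  set b := T + Real.log x / 2 with hbdef
  have hpi := Real.pi_pos
  have h1 : exp (2 * (Complex.sqrt u - T)) = exp ((Real.log x : ℝ) + Real.pi * I) := by
    rw [exp_add, ← ofReal_exp, Real.exp_log hx, exp_pi_mul_I]
    rw [integrandDen] at h
    linear_combination h
  obtain ⟨n, hn⟩ := exp_eq_exp_iff_exists_int.1 h1
  have hv : Complex.sqrt u = (b : ℂ) + ((2 * n + 1 : ℝ) : ℂ) * (Real.pi / 2 * I) := by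
    rw [hbdef]
    push_cast
    linear_combination hn / 2
  have hu : u = pole T x (2 * n + 1) := by rw [← sq_sqrt u, hv, pole]
  rw [hu, pole_im, ← hbdef, abs_mul, abs_mul, abs_of_pos hpi, abs_of_pos hb] at him
  have hle : |(2 * n + 1 : ℝ)| ≤ 2 := by
    by_contra hcon
    have := mul_pos hpi hb
    nlinarith
  have hle' : |2 * n + 1| ≤ 2 := by exact_mod_cast hle
  rw [abs_le] at hle'
  have hn' : n = 0 ∨ n = -1 := by omega
  rcases hn' with rfl | rfl
  · left; rw [hu]; norm_num
  · right; rw [hu]; norm_num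

/-- The integrand at a real point. -/
noncomputable def realIntegrand (T x t : ℝ) : ℝ :=
  x / Real.pi * (1 / Real.sqrt t) *
    (Real.exp (Real.sqrt t - T) / (Real.exp (2 * (Real.sqrt t - T)) + x))

theorem integrand_ofReal (T x : ℝ) {t : ℝ} (ht : 0 ≤ t) :
    integrand T x t = realIntegrand T x t := by
  rw [integrand, realIntegrand, Complex.sqrt_of_nonneg (by exact_mod_cast ht), ofReal_re]
  push_cast
  rfl

theorem rTrap_eq_sum (h : ℝ) (N : ℕ) (x : ℝ) :
    rTrap h N x = h * ∑ j ∈ Finset.Icc 1 N, realIntegrand (truncT h N) x (j * h) := by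
  rw [rTrap, Finset.mul_sum, Finset.mul_sum]
  refine Finset.sum_congr rfl fun j _ => ?_
  rw [realIntegrand, truncT, mul_sub]
  ring

theorem hasDerivAt_arctan_exp_sqrt {T x t : ℝ} (hx : 0 < x) (ht : 0 < t) :
    HasDerivAt (fun t => 2 * Real.sqrt x / Real.pi *
      Real.arctan (Real.exp (Real.sqrt t - T) / Real.sqrt x)) (realIntegrand T x t) t := by
  have hsx : 0 < Real.sqrt x := Real.sqrt_pos.2 hx
  have hst : 0 < Real.sqrt t := Real.sqrt_pos.2 ht
  have := ((((Real.hasDerivAt_sqrt ht.ne').sub_const T).exp.div_const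
    (Real.sqrt x)).arctan).const_mul (2 * Real.sqrt x / Real.pi)
  refine this.congr_deriv ?_
  have hsq : Real.sqrt x ^ 2 = x := Real.sq_sqrt hx.le
  have hE : Real.exp (2 * (Real.sqrt t - T)) = Real.exp (Real.sqrt t - T) ^ 2 := by
    rw [← Real.exp_nat_mul]; norm_num
  rw [realIntegrand, hE, div_pow, hsq]
  have : 0 < Real.exp (Real.sqrt t - T) := Real.exp_pos _
  have hpi := Real.pi_pos
  have hne : 1 + Real.exp (Real.sqrt t - T) ^ 2 / x ≠ 0 := by positivity
  have hne' : Real.exp (Real.sqrt t - T) ^ 2 + x ≠ 0 := by positivity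
  have hne'' : x + Real.exp (Real.sqrt t - T) ^ 2 ≠ 0 := by positivity
  field_simp
  ring

theorem integral_realIntegrand {T x p q : ℝ} (hx : 0 < x) (hp : 0 < p) (hpq : p ≤ q) :
    ∫ t in p..q, realIntegrand T x t = 2 * Real.sqrt x / Real.pi *
      (Real.arctan (Real.exp (Real.sqrt q - T) / Real.sqrt x) -
        Real.arctan (Real.exp (Real.sqrt p - T) / Real.sqrt x)) := by
  rw [mul_sub]
  have hpos : ∀ t ∈ uIcc p q, 0 < t := fun t ht => by
    rw [uIcc_of_le hpq] at ht
    exact hp.trans_le ht.1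
  refine intervalIntegral.integral_eq_sub_of_hasDerivAt
    (fun t ht => hasDerivAt_arctan_exp_sqrt hx (hpos t ht)) ?_
  refine ContinuousOn.intervalIntegrable fun t ht => ?_
  have h1 : Real.sqrt t ≠ 0 := (Real.sqrt_pos.2 (hpos t ht)).ne'
  have h2 : Real.exp (2 * (Real.sqrt t - T)) + x ≠ 0 := by positivity
  unfold realIntegrand
  refine ContinuousAt.continuousWithinAt ?_
  fun_prop (disch := assumption)

/-! ### Error bounds -/

theorem four_mul_truncT_sq {h : ℝ} (hh : 0 ≤ h) (N : ℕ) : 4 * truncT h N ^ 2 = N * h := by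
  rw [truncT, Real.sq_sqrt (by positivity)]
  ring

theorem sqrt_mul_exp_neg (T : ℝ) {x : ℝ} (hx : 0 < x) :
    Real.sqrt x * Real.exp (-(T + Real.log x / 2)) = Real.exp (-T) := by
  have hsx := Real.sqrt_pos.2 hx
  rw [neg_add, Real.exp_add, ← Real.log_sqrt hx.le, Real.exp_neg (Real.log _), Real.exp_log hsx]
  field_simp

/-- The quadrature error against the integral over `[1, 4T² + 1]`. The contour integral accounts
for `12 e^{-T}`; each of the two poles contributes at most `2 e^{-T} / (1 - e^{-b})`, where
`b = T + (log x) / 2 ≥ 2`. -/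
theorem abs_rTrap_sub_integral_le {N : ℕ} (hN : ContourBound (2 * Real.pi ^ 2) N) {x : ℝ}
    (hx : x ∈ Icc (Real.exp (4 - 2 * truncT (2 * Real.pi ^ 2) N)) 1) :
    |rTrap (2 * Real.pi ^ 2) N x - ∫ t in (1 : ℝ)..(4 * truncT (2 * Real.pi ^ 2) N ^ 2 + 1),
      realIntegrand (truncT (2 * Real.pi ^ 2) N) x t| ≤
      (12 + 14 / 3) * Real.exp (-truncT (2 * Real.pi ^ 2) N) := by
  have hpi := Real.pi_pos
  have hpi3 := Real.pi_gt_three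
  have hpi4 := Real.pi_lt_d2
  have hbound := hN x hx
  set h : ℝ := 2 * Real.pi ^ 2 with hh
  have hh0 : 18 < h := by rw [hh]; nlinarith
  have hT2 := four_mul_truncT_sq (by linarith : (0 : ℝ) ≤ h) N
  rw [rTrap_eq_sum]
  set T := truncT h N with hT
  have hx0 : 0 < x := (Real.exp_pos _).trans_le hx.1
  set b := T + Real.log x / 2 with hb
  have hb2 : 2 ≤ b := by
    have := (Real.le_log_iff_exp_le hx0).2 hx.1
    linarith
  have hbT : b ≤ T := by
    have := Real.log_nonpos hx0.le hx.2
    linarith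
  have hb0 : 0 < T + Real.log x / 2 := by linarith
  have hre : ∀ σ : ℝ, σ = 1 ∨ σ = -1 →
      1 < (pole T x σ).re ∧ (pole T x σ).re < 4 * T ^ 2 + 1 := fun σ hσ => by
    have hσ2 : (σ * (Real.pi / 2)) ^ 2 = Real.pi ^ 2 / 4 := by
      rcases hσ with rfl | rfl <;> ring
    rw [pole_re, ← hb, hσ2]
    constructor <;> nlinarith
  have hπb : 0 < Real.pi * b := by positivity
  have him₁ : (pole T x 1).im = Real.pi * b := by rw [pole_im]; ring
  have him₂ : (pole T x (-1)).im = -(Real.pi * b) := by rw [pole_im]; ring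
  have hformula := rectIntegral_mul_charDelta (f := integrand T x) (h := h) (p := 1)
    (q := 4 * T ^ 2 + 1) (a := 2 * Real.pi * b) (N := N)
    (w₁ := pole T x 1) (w₂ := pole T x (-1)) one_pos (by linarith) (by linarith) (by linarith)
    (by nlinarith) (by linarith)
    ⟨hre 1 (.inl rfl), by rw [mem_preimage, him₁]; constructor <;> linarith⟩
    ⟨hre (-1) (.inr rfl), by rw [mem_preimage, him₂]; constructor <;> linarith⟩
    (fun u hu h1 h2 => differentiableAt_integrand T x (by linarith [hu.1.1]) fun h0 => by
      rcases eq_pole_of_integrandDen_eq_zero hx0 hb0 (abs_le.2 hu.2) h0 with h | h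
      exacts [h1 h, h2 h])
    (tendsto_sub_mul_integrand_pole hx0 (.inl rfl) hb0 (one_pos.trans (hre 1 (.inl rfl)).1))
    (tendsto_sub_mul_integrand_pole hx0 (.inr rfl) hb0 (one_pos.trans (hre (-1) (.inr rfl)).1))
  have hint : ∫ t in (1 : ℝ)..(4 * T ^ 2 + 1), integrand T x t =
      ((∫ t in (1 : ℝ)..(4 * T ^ 2 + 1), realIntegrand T x t : ℝ) : ℂ) := by
    rw [← intervalIntegral.integral_ofReal]
    refine intervalIntegral.integral_congr fun t ht => integrand_ofReal T x ?_
    rw [uIcc_of_le (by nlinarith)] at ht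
    linarith [ht.1]
  have hsum : (h : ℂ) * ∑ j ∈ Finset.Icc 1 N, integrand T x (j * h) =
      ((h * ∑ j ∈ Finset.Icc 1 N, realIntegrand T x (j * h) : ℝ) : ℂ) := by
    push_cast
    congr 1
    refine Finset.sum_congr rfl fun j _ => ?_
    rw [← integrand_ofReal T x (by positivity)]
    push_cast
    rfl
  rw [hint, hsum] at hformula
  have hδ : ∀ σ : ℝ, σ = 1 ∨ σ = -1 →
      ‖charDelta h (pole T x σ)‖ ≤ 7 / 6 * Real.exp (-b) := fun σ hσ => by
    have habs : |(pole T x σ).im| = Real.pi * b := by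
      rcases hσ with rfl | rfl
      · rw [him₁, abs_of_pos hπb]
      · rw [him₂, abs_neg, abs_of_pos hπb]
    have hne : (pole T x σ).im ≠ 0 := fun h0 => by
      rw [h0, abs_zero] at habs
      linarith
    have h1 := norm_charDelta_le (by linarith : 0 < h) hne
    rw [habs, show -2 * (Real.pi * (Real.pi * b) / h) = -b by rw [hh]; field_simp] at h1
    -- `e^{-b} ≤ e^{-2} ≤ 1 / 7`
    have hexp : Real.exp (-b) ≤ 1 / 7 := by
      have h2 : Real.exp (-b) ≤ Real.exp (-2) := Real.exp_le_exp.2 (by linarith)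
      have h3 : (7 : ℝ) ≤ Real.exp 2 := by
        have := Real.exp_one_gt_d9
        rw [show (2 : ℝ) = 1 + 1 by norm_num, Real.exp_add]
        nlinarith
      rw [Real.exp_neg 2] at h2
      have h4 : (Real.exp 2)⁻¹ ≤ (7 : ℝ)⁻¹ := inv_anti₀ (by norm_num) h3
      linarith
    have hpos := Real.exp_pos (-b)
    refine h1.trans ((div_le_iff₀ (by linarith)).2 ?_)
    nlinarith
  have hres : ‖2 * (Real.pi : ℂ) * I * (-(((1 : ℝ) : ℂ) * (Real.sqrt x * I / Real.pi)) *
      charDelta h (pole T x 1) + -(((-1 : ℝ) : ℂ) * (Real.sqrt x * I / Real.pi)) *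
      charDelta h (pole T x (-1)))‖ ≤ 14 / 3 * Real.exp (-T) := by
    have hpi' : (Real.pi : ℂ) ≠ 0 := ofReal_ne_zero.2 hpi.ne'
    have heq : 2 * (Real.pi : ℂ) * I * (-(((1 : ℝ) : ℂ) * (Real.sqrt x * I / Real.pi)) *
        charDelta h (pole T x 1) + -(((-1 : ℝ) : ℂ) * (Real.sqrt x * I / Real.pi)) *
        charDelta h (pole T x (-1))) = ((2 * Real.sqrt x : ℝ) : ℂ) *
          (charDelta h (pole T x 1) - charDelta h (pole T x (-1))) := by
      push_cast
      field_simp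
      rw [I_sq]
      ring
    rw [heq, norm_mul, norm_real, Real.norm_of_nonneg (by positivity)]
    have h1 := norm_sub_le (charDelta h (pole T x 1)) (charDelta h (pole T x (-1)))
    have h2 := hδ 1 (.inl rfl)
    have h3 := hδ (-1) (.inr rfl)
    have h4 := sqrt_mul_exp_neg T hx0
    rw [← hb] at h4
    rw [← h4]
    have := mul_le_mul_of_nonneg_left (h1.trans (add_le_add h2 h3))
      (by positivity : 0 ≤ 2 * Real.sqrt x)
    linarith
  have hfinal : ((h * ∑ j ∈ Finset.Icc 1 N, realIntegrand T x (j * h) -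
      ∫ t in (1 : ℝ)..(4 * T ^ 2 + 1), realIntegrand T x t : ℝ) : ℂ) =
      2 * (Real.pi : ℂ) * I * (-(((1 : ℝ) : ℂ) * (Real.sqrt x * I / Real.pi)) *
      charDelta h (pole T x 1) + -(((-1 : ℝ) : ℂ) * (Real.sqrt x * I / Real.pi)) *
      charDelta h (pole T x (-1))) - rectIntegral (fun u => integrand T x u * charDelta h u) 1
        (4 * T ^ 2 + 1) (-(2 * Real.pi * b)) (2 * Real.pi * b) := by
    rw [hformula, ofReal_sub]
    ring
  rw [← Real.norm_eq_abs, ← norm_real, hfinal]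
  refine (norm_sub_le _ _).trans ?_
  linarith

theorem arctan_le_self {y : ℝ} (hy : 0 ≤ y) : Real.arctan y ≤ y := by
  have h := Real.le_tan (Real.arctan_nonneg.2 hy) (Real.arctan_lt_pi_div_two y)
  rwa [Real.tan_arctan] at h

/-- The substitution `s = e^{√u - T}` turns the integral of `realIntegrand T x` into that of
`(2x / π) / (s² + x)`, whose integral over `[0, ∞)` is `√x`. What `[1, 4T² + 1]` leaves out is of
order `e^{-T}` at both ends. -/
theorem abs_integral_sub_sqrt_le {T x : ℝ} (hx : 0 < x) (hx1 : x ≤ 1) :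
    |(∫ t in (1 : ℝ)..(4 * T ^ 2 + 1), realIntegrand T x t) - Real.sqrt x| ≤
      5 / 2 * Real.exp (-T) := by
  have hsx := Real.sqrt_pos.2 hx
  have hpi := Real.pi_gt_three
  rw [integral_realIntegrand hx one_pos (by nlinarith), Real.sqrt_one]
  set R := Real.sqrt (4 * T ^ 2 + 1) with hR
  have hR2 : 2 * T ≤ R := Real.le_sqrt_of_sq_le (by nlinarith)
  set A := Real.exp (R - T) / Real.sqrt x with hA
  set B := Real.exp (1 - T) / Real.sqrt x with hB
  have hA0 : 0 < A := by positivity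
  have hB0 : 0 < B := by positivity
  have harc := Real.arctan_inv_of_pos hA0
  have h1 : Real.arctan A⁻¹ ≤ A⁻¹ := arctan_le_self (by positivity)
  have h2 : Real.arctan B ≤ B := arctan_le_self hB0.le
  have h3 : 0 ≤ Real.arctan A⁻¹ := Real.arctan_nonneg.2 (by positivity)
  have h4 : 0 ≤ Real.arctan B := Real.arctan_nonneg.2 hB0.le
  have heq : 2 * Real.sqrt x / Real.pi * (Real.arctan A - Real.arctan B) - Real.sqrt x =
      -(2 / Real.pi * (Real.sqrt x * (Real.arctan A⁻¹ + Real.arctan B))) := by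
    rw [harc]
    field_simp
    ring
  have hsA : Real.sqrt x * A⁻¹ ≤ Real.exp (-T) := by
    have hexp : Real.exp (T - R) ≤ Real.exp (-T) := Real.exp_le_exp.2 (by linarith)
    have : Real.sqrt x * A⁻¹ = x * Real.exp (T - R) := by
      rw [hA, inv_div, ← neg_sub R T, Real.exp_neg]
      nth_rewrite 3 [← Real.mul_self_sqrt hx.le]
      ring
    rw [this]
    nlinarith [Real.exp_pos (T - R)]
  have hsB : Real.sqrt x * B = Real.exp 1 * Real.exp (-T) := by
    rw [hB, ← Real.exp_add]
    field_simp
    ring_nf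
  have hE := Real.exp_pos (-T)
  have he := Real.exp_one_lt_d9
  have hπ : 2 / Real.pi ≤ 2 / 3 := by gcongr
  rw [heq, abs_neg, abs_of_nonneg (by positivity)]
  have h5 : Real.sqrt x * (Real.arctan A⁻¹ + Real.arctan B) ≤ 3.72 * Real.exp (-T) := by
    have := mul_le_mul_of_nonneg_left (add_le_add h1 h2) hsx.le
    rw [mul_add _ A⁻¹ B, hsB] at this
    nlinarith
  calc 2 / Real.pi * (Real.sqrt x * (Real.arctan A⁻¹ + Real.arctan B))
      ≤ 2 / 3 * (3.72 * Real.exp (-T)) := by gcongr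
    _ ≤ 5 / 2 * Real.exp (-T) := by linarith

theorem sum_inv_sq_le_two (N : ℕ) : ∑ j ∈ Finset.Icc 1 N, 1 / (j : ℝ) ^ 2 ≤ 2 := by
  have key : ∑ j ∈ Finset.Icc 1 N, 1 / (j : ℝ) ^ 2 ≤ 2 - 2 / ((N : ℝ) + 1) := by
    induction N with
    | zero => simp
    | succ n ih =>
      rw [Finset.sum_Icc_succ_top (by omega)]
      have : (1 : ℝ) / ((n + 1 : ℕ) : ℝ) ^ 2 ≤ 2 / ((n : ℝ) + 1) - 2 / (((n + 1 : ℕ) : ℝ) + 1) := by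
        push_cast
        rw [div_sub_div _ _ (by positivity) (by positivity), div_le_div_iff₀ (by positivity)
          (by positivity)]
        nlinarith [(Nat.cast_nonneg n : (0 : ℝ) ≤ n)]
      linarith
  have : (0 : ℝ) ≤ 2 / (N + 1) := by positivity
  linarith

theorem realIntegrand_nonneg {T x : ℝ} (hx : 0 ≤ x) (t : ℝ) : 0 ≤ realIntegrand T x t := by
  unfold realIntegrand
  have := Real.pi_pos
  positivity

/-- For small `x` the decay `e^{-v} ≤ 6 / v³` with `v = √t` suffices. -/
theorem realIntegrand_le {T x t : ℝ} (hx : 0 ≤ x) (ht : 0 < t) :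
    realIntegrand T x t ≤ 6 * (x * Real.exp T) / (Real.pi * t ^ 2) := by
  have hpi := Real.pi_pos
  set v := Real.sqrt t with hv
  have hv0 : 0 < v := Real.sqrt_pos.2 ht
  have ht2 : t ^ 2 = v ^ 4 := by
    rw [hv, show Real.sqrt t ^ 4 = (Real.sqrt t ^ 2) ^ 2 by ring, Real.sq_sqrt ht.le]
  have hexp : v ^ 3 / 6 ≤ Real.exp v := by
    have := Real.pow_div_factorial_le_exp v hv0.le 3
    norm_num [Nat.factorial] at this
    exact this
  have h1 : Real.exp (v - T) / (Real.exp (2 * (v - T)) + x) ≤ Real.exp T / (v ^ 3 / 6) := by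
    calc Real.exp (v - T) / (Real.exp (2 * (v - T)) + x)
        ≤ Real.exp (v - T) / Real.exp (2 * (v - T)) := by gcongr; linarith
      _ = Real.exp T / Real.exp v := by
        rw [← Real.exp_sub, ← Real.exp_sub]
        congr 1
        ring
      _ ≤ Real.exp T / (v ^ 3 / 6) := by gcongr
  calc realIntegrand T x t
      ≤ x / Real.pi * (1 / v) * (Real.exp T / (v ^ 3 / 6)) := by
        unfold realIntegrand
        gcongr
    _ = 6 * (x * Real.exp T) / (Real.pi * t ^ 2) := by
        rw [ht2]
        field_simp

theorem rTrap_nonneg {h : ℝ} (hh : 0 ≤ h) (N : ℕ) {x : ℝ} (hx : 0 ≤ x) : 0 ≤ rTrap h N x := by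
  rw [rTrap_eq_sum]
  exact mul_nonneg hh (Finset.sum_nonneg fun j _ => realIntegrand_nonneg hx _)

theorem rTrap_le {h : ℝ} (hh : 0 < h) (N : ℕ) {x : ℝ} (hx : 0 ≤ x) :
    rTrap h N x ≤ 12 * (x * Real.exp (truncT h N)) / (Real.pi * h) := by
  have hpi := Real.pi_pos
  rw [rTrap_eq_sum]
  set T := truncT h N
  calc h * ∑ j ∈ Finset.Icc 1 N, realIntegrand T x (j * h)
      ≤ h * ∑ j ∈ Finset.Icc 1 N,
          6 * (x * Real.exp T) / (Real.pi * h ^ 2) * (1 / (j : ℝ) ^ 2) := by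
        gcongr with j hj
        have hj1 : (0 : ℝ) < j := by exact_mod_cast (Finset.mem_Icc.1 hj).1
        refine (realIntegrand_le hx (by positivity)).trans (le_of_eq ?_)
        field_simp
    _ = 6 * (x * Real.exp T) / (Real.pi * h) * ∑ j ∈ Finset.Icc 1 N, 1 / (j : ℝ) ^ 2 := by
        rw [← Finset.mul_sum]
        field_simp
    _ ≤ 6 * (x * Real.exp T) / (Real.pi * h) * 2 := by
        gcongr
        exact sum_inv_sq_le_two N
    _ = 12 * (x * Real.exp T) / (Real.pi * h) := by ring

/-- On `[0, e^{4 - 2T})` both `√x` and `r_t(x)` are themselves of order `e^{-T}`. -/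
theorem abs_rTrap_sub_sqrt_lt_of_lt {N : ℕ} {x : ℝ} (hx : 0 ≤ x)
    (hx' : x < Real.exp (4 - 2 * truncT (2 * Real.pi ^ 2) N)) :
    |rTrap (2 * Real.pi ^ 2) N x - Real.sqrt x| <
      20 * Real.exp (-truncT (2 * Real.pi ^ 2) N) := by
  have hpi := Real.pi_gt_three
  have h1 := rTrap_nonneg (by positivity : 0 ≤ 2 * Real.pi ^ 2) N hx
  have h2 := rTrap_le (by positivity : 0 < 2 * Real.pi ^ 2) N hx
  set T := truncT (2 * Real.pi ^ 2) N
  have hE := Real.exp_pos (-T)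
  have he := Real.exp_one_lt_d9
  have he0 := Real.exp_pos 1
  have hs0 := Real.sqrt_nonneg x
  have hexp2 : Real.exp 2 < 7.4 := by
    rw [show (2 : ℝ) = 1 + 1 by norm_num, Real.exp_add]
    nlinarith
  have hexp4 : Real.exp 4 < 55 := by
    rw [show (4 : ℝ) = 2 + 2 by norm_num, Real.exp_add]
    nlinarith [Real.exp_pos 2]
  have hs : Real.sqrt x ≤ 7.4 * Real.exp (-T) := by
    have : Real.sqrt x ≤ Real.exp (2 - T) := by
      refine Real.sqrt_le_iff.2 ⟨(Real.exp_pos _).le, ?_⟩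
      have hsq : Real.exp (2 - T) ^ 2 = Real.exp (4 - 2 * T) := by
        rw [← Real.exp_nat_mul]
        congr 1
        push_cast
        ring
      exact hsq ▸ hx'.le
    rw [sub_eq_add_neg, Real.exp_add] at this
    nlinarith
  have hr : rTrap (2 * Real.pi ^ 2) N x ≤ 13 * Real.exp (-T) := by
    have h3 : x * Real.exp T ≤ 55 * Real.exp (-T) := by
      calc x * Real.exp T ≤ Real.exp (4 - 2 * T) * Real.exp T := by gcongr
        _ = Real.exp 4 * Real.exp (-T) := by
          rw [← Real.exp_add, ← Real.exp_add]
          congr 1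
          ring
        _ ≤ 55 * Real.exp (-T) := by gcongr
    refine h2.trans ((div_le_iff₀ (by positivity)).2 ?_)
    have h4 : 54 ≤ Real.pi * (2 * Real.pi ^ 2) := by nlinarith [sq_nonneg (Real.pi - 3)]
    nlinarith
  rw [abs_lt]
  constructor <;> linarith

theorem abs_rTrap_sub_sqrt_lt {N : ℕ} (hN : ContourBound (2 * Real.pi ^ 2) N) {x : ℝ}
    (hx : x ∈ Icc (0 : ℝ) 1) :
    |rTrap (2 * Real.pi ^ 2) N x - Real.sqrt x| <
      20 * Real.exp (-truncT (2 * Real.pi ^ 2) N) := by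
  rcases lt_or_ge x (Real.exp (4 - 2 * truncT (2 * Real.pi ^ 2) N)) with hlt | hge
  · exact abs_rTrap_sub_sqrt_lt_of_lt hx.1 hlt
  · have h1 := abs_rTrap_sub_integral_le hN ⟨hge, hx.2⟩
    have h2 := abs_integral_sub_sqrt_le (T := truncT (2 * Real.pi ^ 2) N)
      ((Real.exp_pos _).trans_le hge) hx.2
    have hE := Real.exp_pos (-truncT (2 * Real.pi ^ 2) N)
    refine (abs_sub_le _ _ _).trans_lt ((add_le_add h1 h2).trans_lt ?_)
    linarith

theorem tendsto_truncT {h : ℝ} (hh : 0 < h) : Tendsto (truncT h) atTop atTop := by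
  refine Real.tendsto_sqrt_atTop.comp ?_
  exact (tendsto_natCast_atTop_atTop.atTop_mul_const hh).atTop_div_const (by norm_num)

end TrapSqrt

theorem mainTheorem2
    (hbound : ∀ᶠ N : ℕ in atTop, TrapSqrt.ContourBound (2 * Real.pi ^ 2) N) :
    TendstoUniformlyOn (fun (N : ℕ) (x : ℝ) => TrapSqrt.rTrap (2 * Real.pi ^ 2) N x)
        Real.sqrt atTop (Set.Icc 0 1) ∧
      (∀ᶠ N : ℕ in atTop, ∀ x ∈ Set.Icc (0 : ℝ) 1,
        |TrapSqrt.rTrap (2 * Real.pi ^ 2) N x - Real.sqrt x|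
          < 20 * Real.exp (-Real.sqrt (N * (2 * Real.pi ^ 2) / 4))) ∧
      ∀ N : ℕ, 20 * Real.exp (-Real.sqrt (N * (2 * Real.pi ^ 2) / 4))
          = 20 * Real.exp (-(Real.pi * Real.sqrt (N / 2))) := by
  have hmain : ∀ᶠ N : ℕ in atTop, ∀ x ∈ Set.Icc (0 : ℝ) 1,
      |TrapSqrt.rTrap (2 * Real.pi ^ 2) N x - Real.sqrt x|
        < 20 * Real.exp (-TrapSqrt.truncT (2 * Real.pi ^ 2) N) := by
    filter_upwards [hbound] with N hN x hx
    exact TrapSqrt.abs_rTrap_sub_sqrt_lt hN hx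
  refine ⟨?_, hmain, fun N => ?_⟩
  · have hlim : Tendsto (fun N => 20 * Real.exp (-TrapSqrt.truncT (2 * Real.pi ^ 2) N)) atTop
        (𝓝 0) := by
      have := (Real.tendsto_exp_neg_atTop_nhds_zero.comp
        (TrapSqrt.tendsto_truncT (h := 2 * Real.pi ^ 2) (by positivity))).const_mul 20
      simpa using this
    rw [Metric.tendstoUniformlyOn_iff]
    intro ε hε
    filter_upwards [hmain, hlim.eventually_lt_const hε] with N hN hNε x hx
    rw [dist_comm, Real.dist_eq]
    exact (hN x hx).trans hNε
  · rw [show (N : ℝ) * (2 * Real.pi ^ 2) / 4 = Real.pi ^ 2 * (N / 2) by ring,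
      Real.sqrt_mul (by positivity), Real.sqrt_sq Real.pi_pos.le]
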